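/- **Notation.** Let $\mathbb{C}_+=\{s\in\mathbb{C}:\Re s>0\}$ and let $\bar{\mathbb{C}}_+$ be its closure. $H_\infty$ is the set of matrix-valued functions that are analytic in $\mathbb{C}_+$ and whose largest singular value is bounded on $\mathbb{C}_+$. $\mathbf{S}^{n\times n}$ is the set of $n\times n$ matrix-valued functions $X$ on $\bar{\mathbb{C}}_+$ that belong to $H_\infty$, are continuous at every point of the imaginary axis $j\mathbb{R}$ (as functions on $\bar{\mathbb{C}}_+$), and for which $X(j\omega)$ tends to one and the same matrix $X(\infty)$ as $\omega\to+\infty$ and as $\omega\to-\infty$. All transfer functions are real, i.e. $X(\bar s)=\overline{X(s)}$ (entrywise conjugate) for $s\in\bar{\mathbb{C}}_+$. For matrices, $A\ge 0$ (resp. $A>0$) means Hermitian positive semidefinite (resp. definite). A real $R\in\mathbf{S}^{n\times n}$ is *stable negative imaginary* if $j[R(j\omega)-R(j\omega)^*]\ge 0$ for all $\omega\in(0,\infty)$, and *strictly negative imaginary* if $j[R(j\omega)-R(j\omega)^*]>0$ for all $\omega\in(0,\infty)$. The positive feedback interconnection $[G,\bar G]$ is *internally stable* if $\begin{pmatrix}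 I&-\bar G\\-G&I\end{pmatrix}^{-1}$ exists throughout $\mathbb{C}_+$ and is an element of $H_\infty$. **Proposition.** Let $\bar G$ be an $n\times n$ strictly negative imaginary and $G$ an $n\times n$ stable negative imaginary transfer function, possibly irrational. Suppose that $\bar G(\infty)\ge 0$, that $G(\infty)\bar G(\infty)=0$, and that the spectral radius of $G(0)\bar G(0)$ is less than $1$. Then $[\tau G,\bar G]$ is internally stable for every $\tau\in[0,1]$. -/

import Mathlib

open Filter Topology ComplexConjugate
open scoped ComplexOrder

namespace NegImag

/-- The open right half plane. -/
def openRHP : Set ℂ := {s | 0 < s.re}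

/-- The closed right half plane. -/
def closedRHP : Set ℂ := {s | 0 ≤ s.re}

open scoped Matrix.Norms.L2Operator in
/-- The largest singular value of a complex matrix, that is, its operator norm with respect to
the Euclidean norms. -/
noncomputable def maxSingularValue {m k : Type*} [Fintype m] [Fintype k] [DecidableEq k]
    (A : Matrix m k ℂ) : ℝ := ‖A‖

/-- `X ∈ H∞`: each entry of `X` is analytic in the open right half plane, and the largest
singular value of `X s` is bounded there. -/
def MemHinf {m k : Type*} [Fintype m] [Fintype k] [DecidableEq k]
    (X : ℂ → Matrix m k ℂ) : Prop :=
  (∀ i j, DifferentiableOn ℂ (fun s => X s i j) openRHP) ∧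
    ∃ C : ℝ, ∀ s ∈ openRHP, maxSingularValue (X s) ≤ C

/-- `X(∞) = L`: the boundary function `ω ↦ X (jω)` tends to `L` as `ω → +∞` and as `ω → -∞`. -/
def HasValueAtInfty {m k : Type*} (X : ℂ → Matrix m k ℂ) (L : Matrix m k ℂ) : Prop :=
  Tendsto (fun ω : ℝ => X (ω * Complex.I)) atTop (𝓝 L) ∧
    Tendsto (fun ω : ℝ => X (ω * Complex.I)) atBot (𝓝 L)

/-- The class `S = H∞ ∩ C` of stable transfer functions that are continuous on `jℝ ∪ {∞}`.
The values on `jℝ` are the boundary values of the function on the open right half plane: `X`,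
as a function on the closed right half plane, is continuous at each point of `jℝ`. -/
def MemS {m k : Type*} [Fintype m] [Fintype k] [DecidableEq k]
    (X : ℂ → Matrix m k ℂ) : Prop :=
  MemHinf X ∧
    (∀ ω : ℝ, ContinuousWithinAt X closedRHP (ω * Complex.I)) ∧
    ∃ L : Matrix m k ℂ, HasValueAtInfty X L

/-- `X` is a real transfer function: `X(s̄)` is the entrywise conjugate of `X(s)`. -/
def IsRealTF {m k : Type*} (X : ℂ → Matrix m k ℂ) : Prop :=
  ∀ s ∈ closedRHP, X (conj s) = (X s).map conj

/-- Stable negative imaginary: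
`R ∈ S` is real and `j[R(jω) - R(jω)^*] ≥ 0` for all `ω ∈ (0, ∞)`. -/
def StableNegativeImaginary {n : ℕ} (R : ℂ → Matrix (Fin n) (Fin n) ℂ) : Prop :=
  MemS R ∧ IsRealTF R ∧ ∀ ω : ℝ, 0 < ω →
    (Complex.I • (R (ω * Complex.I) - (R (ω * Complex.I)).conjTranspose)).PosSemidef

/-- Strictly negative imaginary:
`R ∈ S` is real and `j[R(jω) - R(jω)^*] > 0` for all `ω ∈ (0, ∞)`. -/
def StrictlyNegativeImaginary {n : ℕ} (R : ℂ → Matrix (Fin n) (Fin n) ℂ) : Prop :=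
  MemS R ∧ IsRealTF R ∧ ∀ ω : ℝ, 0 < ω →
    (Complex.I • (R (ω * Complex.I) - (R (ω * Complex.I)).conjTranspose)).PosDef

/-- The block transfer function `[I, -Ḡ; -G, I]`, which maps the internal signals `(u₁, u₂)` of
the positive feedback interconnection `[G, Ḡ]` to the external signals `(d₁, d₂)`. -/
def loopMatrix {n : ℕ} (G Gbar : ℂ → Matrix (Fin n) (Fin n) ℂ) (s : ℂ) :
    Matrix (Fin n ⊕ Fin n) (Fin n ⊕ Fin n) ℂ :=
  Matrix.fromBlocks 1 (-Gbar s) (-G s) 1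

/-- `[G, Ḡ]` is internally stable: `[I, -Ḡ; -G, I]` is invertible throughout the open right half
plane and its inverse is an element of `H∞`. -/
def InternallyStable {n : ℕ} (G Gbar : ℂ → Matrix (Fin n) (Fin n) ℂ) : Prop :=
  (∀ s ∈ openRHP, IsUnit (loopMatrix G Gbar s)) ∧
    MemHinf (fun s => (loopMatrix G Gbar s)⁻¹)

end NegImag

/-! The inverse loop is adjugate over determinant, so stability reduces to a positive lower bound
for |det(1 - τ G Gbar)| on the open half plane. On the imaginary axis the determinant has no zero:
by the sign of the quadratic forms for ω > 0, conjugation for ω < 0, the spectral radius at 0, and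
the vanishing product at ∞. Compactness then gives one bound c for all gains
(`exists_le_norm_det_boundary`). No limit at ∞ inside the half plane is available, so zeros are not
counted; the gain is continued from τ = 0 instead. A step of fixed length δ loses at most c/2, and
Phragmén–Lindelöf for 1/det restores c (`le_norm_det_of_boundary`). -/

open Matrix in
/-- The feedback loop of a strictly negative imaginary and a negative imaginary matrix is
nonsingular. -/
theorem det_one_sub_mul_ne_zero {m : Type*} [Fintype m] [DecidableEq m] {A B : Matrix m m ℂ}
    (hA : (Complex.I • (A - Aᴴ)).PosSemidef) (hB : (Complex.I • (B - Bᴴ)).PosDef)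
    {τ : ℝ} (hτ : 0 ≤ τ) : (1 - ((τ : ℂ) • A) * B).det ≠ 0 := by
  intro h
  obtain ⟨v, hv, h0⟩ := Matrix.exists_mulVec_eq_zero_iff.mpr h
  have hv2 : (τ : ℂ) • (A *ᵥ (B *ᵥ v)) = v := by
    rw [sub_mulVec, one_mulVec, ← mulVec_mulVec, smul_mulVec, sub_eq_zero] at h0
    exact h0.symm
  have key : ∀ (M : Matrix m m ℂ) (x : m → ℂ), star x ⬝ᵥ ((Complex.I • (M - Mᴴ)) *ᵥ x)
      = Complex.I * (star x ⬝ᵥ (M *ᵥ x) - star (M *ᵥ x) ⬝ᵥ x) := by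
    intro M x
    rw [smul_mulVec, dotProduct_smul, sub_mulVec, dotProduct_sub, star_mulVec,
      ← dotProduct_mulVec, smul_eq_mul]
  have h1 := hB.dotProduct_mulVec_pos hv
  have h2 := hA.dotProduct_mulVec_nonneg (B *ᵥ v)
  rw [key] at h1 h2
  set y := B *ᵥ v with hy
  have h3 : (0 : ℂ) ≤ (τ : ℂ) * (Complex.I * (star y ⬝ᵥ (A *ᵥ y) - star (A *ᵥ y) ⬝ᵥ y)) :=
    mul_nonneg (by exact_mod_cast hτ) h2
  have e1 : (τ : ℂ) * (star y ⬝ᵥ (A *ᵥ y)) = star y ⬝ᵥ v := by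
    conv_rhs => rw [← hv2, dotProduct_smul, smul_eq_mul]
  have e2 : (τ : ℂ) * (star (A *ᵥ y) ⬝ᵥ y) = star v ⬝ᵥ y := by
    conv_rhs => rw [← hv2, star_smul, smul_dotProduct, smul_eq_mul]
    simp
  have h4 := add_pos_of_pos_of_nonneg h1 h3
  -- Since τAy = v and y = Bv, the two forms are opposite, yet their sum is positive.
  have h5 : Complex.I * (star v ⬝ᵥ y - star y ⬝ᵥ v) +
      (τ : ℂ) * (Complex.I * (star y ⬝ᵥ (A *ᵥ y) - star (A *ᵥ y) ⬝ᵥ y)) = 0 := by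
    linear_combination Complex.I * e1 - Complex.I * e2
  exact absurd h5 h4.ne'

theorem det_one_sub_smul_ne_zero_of_spectralRadius_lt_one {m : Type*} [Fintype m]
    [DecidableEq m] {M : Matrix m m ℂ} (hM : spectralRadius ℂ M < 1) {τ : ℝ}
    (hτ : τ ∈ Set.Icc (0 : ℝ) 1) : (1 - (τ : ℂ) • M).det ≠ 0 := by
  rcases hτ.1.eq_or_lt with rfl | h0
  · simp
  have hc : (τ : ℂ) ≠ 0 := by exact_mod_cast h0.ne'
  have hn : spectralRadius ℂ M < ‖(τ : ℂ)⁻¹‖₊ := by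
    refine hM.trans_le ?_
    have : (1 : ℝ) ≤ ‖(τ : ℂ)⁻¹‖ := by
      rw [norm_inv, Complex.norm_real, Real.norm_of_nonneg hτ.1]
      exact (one_le_inv₀ h0).mpr hτ.2
    exact_mod_cast this
  have hu := (Matrix.isUnit_iff_isUnit_det _).mp
    (spectrum.mem_resolventSet_iff.mp (spectrum.mem_resolventSet_of_spectralRadius_lt hn))
  have he : 1 - (τ : ℂ) • M = (τ : ℂ) • (algebraMap ℂ (Matrix m m ℂ) (τ : ℂ)⁻¹ - M) := by
    rw [smul_sub, Algebra.algebraMap_eq_smul_one, smul_smul, mul_inv_cancel₀ hc, one_smul]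
  rw [he, Matrix.det_smul]
  exact mul_ne_zero (pow_ne_zero _ hc) hu.ne_zero

/-! ### Analytic and compactness tools -/

theorem DifferentiableOn.matrix_det {m : Type*} [Fintype m] [DecidableEq m]
    {X : ℂ → Matrix m m ℂ} {S : Set ℂ}
    (hX : ∀ i j, DifferentiableOn ℂ (fun s => X s i j) S) :
    DifferentiableOn ℂ (fun s => (X s).det) S := by
  simp only [Matrix.det_apply]
  refine DifferentiableOn.fun_sum fun σ _ => DifferentiableOn.const_smul ?_ _
  exact DifferentiableOn.fun_finsetProd fun i _ => hX _ _

theorem DifferentiableOn.matrix_inv {m : Type*} [Fintype m] [DecidableEq m]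
    {X : ℂ → Matrix m m ℂ} {S : Set ℂ}
    (hX : ∀ i j, DifferentiableOn ℂ (fun s => X s i j) S) (hdet : ∀ s ∈ S, (X s).det ≠ 0)
    (i j : m) : DifferentiableOn ℂ (fun s => (X s)⁻¹ i j) S := by
  simp only [Matrix.inv_def, Ring.inverse_eq_inv', Matrix.smul_apply, smul_eq_mul,
    Matrix.adjugate_apply]
  refine ((DifferentiableOn.matrix_det hX).inv hdet).mul (DifferentiableOn.matrix_det ?_)
  intro a b
  by_cases h : a = j
  · subst h
    simp only [Matrix.updateRow_self]
    exact differentiableOn_const _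
  · simp only [Matrix.updateRow_ne h]
    exact hX a b

/-- Minimum modulus principle in the right half plane. -/
theorem le_norm_of_le_norm_of_im_axis {f : ℂ → ℂ} {c ε : ℝ} (hc : 0 < c) (hε : 0 < ε)
    (hd : DiffContOnCl ℂ f {z | 0 < z.re}) (hlow : ∀ z : ℂ, 0 < z.re → ε ≤ ‖f z‖)
    (him : ∀ ω : ℝ, c ≤ ‖f (ω * Complex.I)‖) {z : ℂ} (hz : 0 < z.re) : c ≤ ‖f z‖ := by
  have hne : ∀ w ∈ closure {z : ℂ | 0 < z.re}, f w ≠ 0 := by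
    intro w hw
    rw [Complex.closure_setOfPred_lt_re] at hw
    rcases (show (0 : ℝ) ≤ w.re from hw).eq_or_lt with h | h
    · have : w = (w.im : ℂ) * Complex.I := by
        apply Complex.ext <;> simp [← h]
      rw [this]
      exact norm_pos_iff.mp (hc.trans_le (him _))
    · exact norm_pos_iff.mp (hε.trans_le (hlow w h))
  have hb : ∀ w : ℂ, 0 < w.re → ‖(f w)⁻¹‖ ≤ ε⁻¹ := by
    intro w hw
    rw [norm_inv]
    exact inv_anti₀ hε (hlow w hw)
  -- The size of ε is irrelevant: it only makes 1/f bounded, so the growth condition holds with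
  -- exponent 0 and the axis bound decides.
  have h := PhragmenLindelof.right_half_plane_of_bounded_on_real (f := fun w => (f w)⁻¹)
    (C := c⁻¹) (hd.inv hne) ⟨0, by norm_num, 0, ?_⟩ ?_ ?_ hz.le
  · rw [norm_inv] at h
    exact (inv_le_inv₀ (hε.trans_le (hlow z hz)) hc).mp h
  · refine Asymptotics.IsBigO.of_bound ε⁻¹ ?_
    filter_upwards [mem_inf_of_right (mem_principal_self _)] with w hw
    simpa using hb w hw
  · refine ⟨ε⁻¹, ?_⟩
    rw [eventually_map]
    filter_upwards [eventually_gt_atTop 0] with x hx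
    exact hb x (by simpa using hx)
  · intro ω
    rw [norm_inv]
    exact inv_anti₀ hc (him ω)

/-- The triples (τ, τ', q) violating the estimate lie in a compact set where |τ - τ'| is positive;
half its minimum serves as δ. -/
theorem exists_norm_sub_le_of_isCompact {X : Type*} [TopologicalSpace X] {K : Set X}
    (hK : IsCompact K) {f : ℝ × X → ℂ} (hf : Continuous f) {ε : ℝ} (hε : 0 < ε) :
    ∃ δ > 0, ∀ τ ∈ Set.Icc (0 : ℝ) 1, ∀ τ' ∈ Set.Icc (0 : ℝ) 1, |τ - τ'| ≤ δ →
      ∀ q ∈ K, ‖f (τ', q)‖ - ε ≤ ‖f (τ, q)‖ := by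
  have hI := isCompact_Icc (a := (0 : ℝ)) (b := 1)
  have hS := (hI.prod (hI.prod hK)).inter_right
    (isClosed_le (by fun_prop) (by fun_prop) :
      IsClosed {p : ℝ × ℝ × X | ‖f (p.1, p.2.2)‖ ≤ ‖f (p.2.1, p.2.2)‖ - ε})
  rcases Set.eq_empty_or_nonempty ((Set.Icc (0 : ℝ) 1 ×ˢ Set.Icc (0 : ℝ) 1 ×ˢ K) ∩
      {p : ℝ × ℝ × X | ‖f (p.1, p.2.2)‖ ≤ ‖f (p.2.1, p.2.2)‖ - ε}) with he | hne
  · refine ⟨1, one_pos, fun τ hτ τ' hτ' _ q hq => ?_⟩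
    by_contra! h
    have : (τ, τ', q) ∈ (∅ : Set (ℝ × ℝ × X)) := he ▸ ⟨⟨hτ, hτ', hq⟩, h.le⟩
    exact this
  · obtain ⟨⟨a, b, r⟩, hp, hmin⟩ := hS.exists_isMinOn hne
      (show Continuous fun p : ℝ × ℝ × X => |p.1 - p.2.1| by fun_prop).continuousOn
    have hpos : 0 < |a - b| := by
      rw [abs_pos, sub_ne_zero]
      rintro rfl
      have : ‖f (a, r)‖ ≤ ‖f (a, r)‖ - ε := hp.2
      linarith
    refine ⟨|a - b| / 2, half_pos hpos, fun τ hτ τ' hτ' hd q hq => ?_⟩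
    by_contra! h
    have : |a - b| ≤ |τ - τ'| := hmin (a := (τ, τ', q)) ⟨⟨hτ, hτ', hq⟩, h.le⟩
    linarith

/-! ### Boundedness and continuity of transfer functions -/

namespace NegImag

section MaxSingularValue

variable {m k : Type*} [Fintype m] [Fintype k] [DecidableEq k]

open scoped Matrix.Norms.L2Operator in
theorem continuous_maxSingularValue :
    Continuous (maxSingularValue : Matrix m k ℂ → ℝ) :=
  continuous_norm (E := Matrix m k ℂ)

open scoped Matrix.Norms.L2Operator in
-- Confines the values of an H∞ function to a compact set, which makes estimates uniform in s.
theorem isCompact_maxSingularValue_le (C : ℝ) :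
    IsCompact {A : Matrix m k ℂ | maxSingularValue A ≤ C} := by
  have : ProperSpace (Matrix m k ℂ) := FiniteDimensional.proper ℂ _
  have h := isCompact_closedBall (0 : Matrix m k ℂ) C
  have he : {A : Matrix m k ℂ | maxSingularValue A ≤ C} = Metric.closedBall 0 C := by
    ext A
    rw [mem_closedBall_zero_iff]
    rfl
  rw [he]
  exact h

end MaxSingularValue

theorem mul_I_mem_closedRHP (ω : ℝ) : (ω : ℂ) * Complex.I ∈ closedRHP := by
  simp [closedRHP]

theorem closure_openRHP : closure openRHP = closedRHP :=
  Complex.closure_setOfPred_lt_re 0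

theorem isOpen_openRHP : IsOpen openRHP :=
  isOpen_lt continuous_const Complex.continuous_re

theorem HasValueAtInfty.tendsto_cocompact {m k : Type*} {X : ℂ → Matrix m k ℂ}
    {L : Matrix m k ℂ} (hL : HasValueAtInfty X L) :
    Tendsto (fun ω : ℝ => X (ω * Complex.I)) (cocompact ℝ) (𝓝 L) := by
  rw [cocompact_eq_atBot_atTop]
  exact hL.2.sup hL.1

section MemS

variable {m k : Type*} [Fintype m] [Fintype k] [DecidableEq k] {X : ℂ → Matrix m k ℂ}

theorem MemS.continuousOn_closedRHP (hX : MemS X) : ContinuousOn X closedRHP := by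
  intro s hs
  rcases (show (0 : ℝ) ≤ s.re from hs).eq_or_lt with h | h
  · have : s = (s.im : ℂ) * Complex.I := by
      apply Complex.ext <;> simp [← h]
    rw [this]
    exact hX.2.1 _
  · refine ContinuousAt.continuousWithinAt ?_
    refine continuousAt_pi.mpr fun i => continuousAt_pi.mpr fun j => ?_
    exact ((hX.1.1 i j).differentiableAt (isOpen_openRHP.mem_nhds h)).continuousAt

theorem MemS.continuous_boundary (hX : MemS X) :
    Continuous fun ω : ℝ => X (ω * Complex.I) :=
  hX.continuousOn_closedRHP.comp_continuous (by fun_prop) mul_I_mem_closedRHP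

end MemS

variable {n : ℕ}

/-- The loop matrix `[I, -B; -τA, I]` as a function of `(τ, (A, B))`. -/
def constLoop (p : ℝ × Matrix (Fin n) (Fin n) ℂ × Matrix (Fin n) (Fin n) ℂ) :
    Matrix (Fin n ⊕ Fin n) (Fin n ⊕ Fin n) ℂ :=
  Matrix.fromBlocks 1 (-p.2.2) (-((p.1 : ℂ) • p.2.1)) 1

theorem continuous_constLoop : Continuous (constLoop (n := n)) := by
  unfold constLoop
  refine Continuous.matrix_fromBlocks continuous_const (by fun_prop) ?_ continuous_const
  exact ((Complex.continuous_ofReal.comp continuous_fst).smul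
    (continuous_fst.comp continuous_snd)).neg

theorem det_constLoop (p : ℝ × Matrix (Fin n) (Fin n) ℂ × Matrix (Fin n) (Fin n) ℂ) :
    (constLoop p).det = (1 - ((p.1 : ℂ) • p.2.1) * p.2.2).det := by
  rw [constLoop, Matrix.det_fromBlocks_one₁₁, neg_mul_neg]

theorem continuous_det_constLoop : Continuous fun p => (constLoop (n := n) p).det :=
  continuous_constLoop.matrix_det

/-! ### The loop determinant -/

section Loop

variable {G Gbar : ℂ → Matrix (Fin n) (Fin n) ℂ}

theorem det_boundary_ne_zero (hGbar : StrictlyNegativeImaginary Gbar)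
    (hG : StableNegativeImaginary G) (hDC : spectralRadius ℂ (G 0 * Gbar 0) < 1)
    {τ : ℝ} (hτ : τ ∈ Set.Icc (0 : ℝ) 1) (ω : ℝ) :
    (constLoop (τ, G (ω * Complex.I), Gbar (ω * Complex.I))).det ≠ 0 := by
  rw [det_constLoop]
  dsimp only
  have pos : ∀ ω : ℝ, 0 < ω →
      (1 - ((τ : ℂ) • G (ω * Complex.I)) * Gbar (ω * Complex.I)).det ≠ 0 :=
    fun ω hω => det_one_sub_mul_ne_zero (hG.2.2 ω hω) (hGbar.2.2 ω hω) hτ.1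
  rcases lt_trichotomy ω 0 with h | rfl | h
  · have hs : (ω : ℂ) * Complex.I = conj (((-ω : ℝ) : ℂ) * Complex.I) := by simp
    rw [hs, hG.2.1 _ (mul_I_mem_closedRHP _), hGbar.2.1 _ (mul_I_mem_closedRHP _)]
    have := pos (-ω) (by linarith)
    set A := G (((-ω : ℝ) : ℂ) * Complex.I)
    set B := Gbar (((-ω : ℝ) : ℂ) * Complex.I)
    have he : 1 - ((τ : ℂ) • A.map conj) * B.map conj
        = (starRingEnd ℂ).mapMatrix (1 - ((τ : ℂ) • A) * B) := by
      rw [map_sub, map_mul, map_one]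
      congr 2
      ext i j
      simp
    rw [he, ← RingHom.map_det]
    exact (map_ne_zero _).mpr this
  · rw [Complex.ofReal_zero, zero_mul, Matrix.smul_mul]
    exact det_one_sub_smul_ne_zero_of_spectralRadius_lt_one hDC hτ
  · exact pos ω h

/-- The determinant of the loop matrix is bounded away from zero on the imaginary axis,
uniformly in the gain. -/
theorem exists_le_norm_det_boundary (hGbar : StrictlyNegativeImaginary Gbar)
    (hG : StableNegativeImaginary G) {Ginf Gbarinf : Matrix (Fin n) (Fin n) ℂ}
    (hGinf : HasValueAtInfty G Ginf) (hGbarinf : HasValueAtInfty Gbar Gbarinf)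
    (hprod : Ginf * Gbarinf = 0) (hDC : spectralRadius ℂ (G 0 * Gbar 0) < 1) :
    ∃ c > 0, ∀ τ ∈ Set.Icc (0 : ℝ) 1, ∀ ω : ℝ,
      c ≤ ‖(constLoop (τ, G (ω * Complex.I), Gbar (ω * Complex.I))).det‖ := by
  -- Adjoining the common limit at ±∞ makes the boundary curve of the pair (G, Gbar) compact.
  have hP := (hGinf.tendsto_cocompact.prodMk_nhds
    hGbarinf.tendsto_cocompact).isCompact_insert_range_of_cocompact
    (hG.1.continuous_boundary.prodMk hGbar.1.continuous_boundary)
  have hK := (isCompact_Icc (a := (0 : ℝ)) (b := 1)).prod hP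
  obtain ⟨p, hp, hmin⟩ := hK.exists_isMinOn
    ⟨(0, _), ⟨by simp, Set.mem_insert _ _⟩⟩ continuous_det_constLoop.norm.continuousOn
  refine ⟨_, norm_pos_iff.mpr ?_, fun τ hτ ω => hmin ⟨hτ, Set.mem_insert_of_mem _ ⟨ω, rfl⟩⟩⟩
  obtain ⟨τ, q⟩ := p
  obtain ⟨hτ, rfl | ⟨ω, rfl⟩⟩ := hp
  · rw [det_constLoop]
    simp [hprod]
  · exact det_boundary_ne_zero hGbar hG hDC hτ ω

theorem diffContOnCl_det (hGbar : MemS Gbar) (hG : MemS G) (τ : ℝ) :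
    DiffContOnCl ℂ (fun s => (constLoop (τ, G s, Gbar s)).det) openRHP := by
  refine ⟨DifferentiableOn.matrix_det ?_, ?_⟩
  · rintro (i | i) (j | j)
    · exact differentiableOn_const _
    · exact (hGbar.1.1 i j).neg
    · exact ((hG.1.1 i j).const_smul (τ : ℂ)).neg
    · exact differentiableOn_const _
  · rw [closure_openRHP]
    exact continuous_det_constLoop.comp_continuousOn
      (continuousOn_const.prodMk
        (hG.continuousOn_closedRHP.prodMk hGbar.continuousOn_closedRHP))

/-- If the determinant of the loop matrix is bounded away from zero on the imaginary axis
uniformly in the gain, then the same holds in the right half plane. -/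
theorem le_norm_det_of_boundary (hGbar : MemS Gbar) (hG : MemS G) {c : ℝ} (hc : 0 < c)
    (hbd : ∀ τ ∈ Set.Icc (0 : ℝ) 1, ∀ ω : ℝ,
      c ≤ ‖(constLoop (τ, G (ω * Complex.I), Gbar (ω * Complex.I))).det‖)
    {τ : ℝ} (hτ : τ ∈ Set.Icc (0 : ℝ) 1) {s : ℂ} (hs : s ∈ openRHP) :
    c ≤ ‖(constLoop (τ, G s, Gbar s)).det‖ := by
  -- Any positive lower bound in the half plane improves to c, so losses do not accumulate over the
  -- steps.
  have upgrade : ∀ τ ∈ Set.Icc (0 : ℝ) 1, ∀ ε > 0,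
      (∀ s ∈ openRHP, ε ≤ ‖(constLoop (τ, G s, Gbar s)).det‖) →
      ∀ s ∈ openRHP, c ≤ ‖(constLoop (τ, G s, Gbar s)).det‖ :=
    fun τ hτ ε hε h s hs => le_norm_of_le_norm_of_im_axis
      (f := fun s => (constLoop (τ, G s, Gbar s)).det) hc hε
      (diffContOnCl_det hGbar hG τ) h (hbd τ hτ) hs
  obtain ⟨C₁, hC₁⟩ := hG.1.2
  obtain ⟨C₂, hC₂⟩ := hGbar.1.2
  obtain ⟨δ, hδ, hstep⟩ := exists_norm_sub_le_of_isCompact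
    ((isCompact_maxSingularValue_le (m := Fin n) (k := Fin n) C₁).prod
      (isCompact_maxSingularValue_le (m := Fin n) (k := Fin n) C₂))
    (continuous_det_constLoop (n := n)) (half_pos hc)
  have main : ∀ k : ℕ, ∀ τ ∈ Set.Icc (0 : ℝ) 1, τ ≤ k * δ →
      ∀ s ∈ openRHP, c ≤ ‖(constLoop (τ, G s, Gbar s)).det‖ := by
    intro k
    induction k with
    | zero =>
      intro τ hτ hk
      obtain rfl : τ = 0 := le_antisymm (by simpa using hk) hτ.1
      refine upgrade 0 hτ 1 one_pos fun s _ => ?_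
      rw [det_constLoop]
      simp
    | succ k ih =>
      intro τ hτ hk
      -- Truncation at 0 keeps the previous gain admissible when τ < δ.
      have hm : max (τ - δ) 0 ∈ Set.Icc (0 : ℝ) 1 :=
        ⟨le_max_right _ _, max_le (by linarith [hτ.2]) zero_le_one⟩
      have hk' : max (τ - δ) 0 ≤ k * δ := by
        push_cast at hk
        exact max_le (by linarith) (by positivity)
      refine upgrade τ hτ (c / 2) (half_pos hc) fun s hs => ?_
      have h1 := ih _ hm hk' s hs
      have h2 := hstep τ hτ _ hm (by
        rw [abs_le]
        constructor
        · linarith [max_le (show τ - δ ≤ τ by linarith) hτ.1]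
        · linarith [le_max_left (τ - δ) 0]) (G s, Gbar s) ⟨hC₁ s hs, hC₂ s hs⟩
      linarith
  obtain ⟨k, hk⟩ := exists_nat_ge (τ / δ)
  exact main k τ hτ ((div_le_iff₀ hδ).mp hk) s hs

/-- The inverse depends continuously on the matrix pair where |det| ≥ c, and the values of the pair
stay in a compact part of that set. -/
theorem internallyStable_of_le_norm_det (hGbar : MemS Gbar) (hG : MemS G) {c τ : ℝ}
    (hc : 0 < c) (hdet : ∀ s ∈ openRHP, c ≤ ‖(constLoop (τ, G s, Gbar s)).det‖) :
    InternallyStable (fun s => (τ : ℂ) • G s) Gbar := by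
  have hne : ∀ s ∈ openRHP, (constLoop (τ, G s, Gbar s)).det ≠ 0 :=
    fun s hs => norm_pos_iff.mp (hc.trans_le (hdet s hs))
  refine ⟨fun s hs => (Matrix.isUnit_iff_isUnit_det _).mpr (hne s hs).isUnit,
    DifferentiableOn.matrix_inv ?_ hne, ?_⟩
  · rintro (i | i) (j | j)
    · exact differentiableOn_const _
    · exact (hGbar.1.1 i j).neg
    · exact ((hG.1.1 i j).const_smul (τ : ℂ)).neg
    · exact differentiableOn_const _
  obtain ⟨C₁, hC₁⟩ := hG.1.2
  obtain ⟨C₂, hC₂⟩ := hGbar.1.2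
  have hQ := ((isCompact_singleton (x := τ)).prod
    ((isCompact_maxSingularValue_le (m := Fin n) (k := Fin n) C₁).prod
      (isCompact_maxSingularValue_le (m := Fin n) (k := Fin n) C₂))).inter_right
    (isClosed_le continuous_const continuous_det_constLoop.norm :
      IsClosed {p | c ≤ ‖(constLoop (n := n) p).det‖})
  have hcont : ContinuousOn (fun p => maxSingularValue (constLoop (n := n) p)⁻¹)
      {p | c ≤ ‖(constLoop (n := n) p).det‖} := by
    refine continuous_maxSingularValue.comp_continuousOn ?_
    simp only [Matrix.inv_def, Ring.inverse_eq_inv']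
    refine ContinuousOn.smul (continuous_det_constLoop.continuousOn.inv₀ ?_)
      continuous_constLoop.matrix_adjugate.continuousOn
    exact fun p hp => norm_pos_iff.mp (hc.trans_le hp)
  obtain ⟨C, hC⟩ := hQ.bddAbove_image (hcont.mono Set.inter_subset_right)
  exact ⟨C, fun s hs => hC ⟨(τ, G s, Gbar s), ⟨⟨rfl, hC₁ s hs, hC₂ s hs⟩, hdet s hs⟩, rfl⟩⟩

end Loop

end NegImag

theorem mainTheorem6 (n : ℕ) (G Gbar : ℂ → Matrix (Fin n) (Fin n) ℂ)
    (hGbar : NegImag.StrictlyNegativeImaginary Gbar)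
    (hG : NegImag.StableNegativeImaginary G)
    (Ginf Gbarinf : Matrix (Fin n) (Fin n) ℂ)
    (hGinf : NegImag.HasValueAtInfty G Ginf)
    (hGbarinf : NegImag.HasValueAtInfty Gbar Gbarinf)
    (hpos : Gbarinf.PosSemidef)
    (hprod : Ginf * Gbarinf = 0)
    (hDC : spectralRadius ℂ (G 0 * Gbar 0) < 1) :
    ∀ τ ∈ Set.Icc (0 : ℝ) 1,
      NegImag.InternallyStable (fun s => (τ : ℂ) • G s) Gbar := by
  intro τ hτ
  obtain ⟨c, hc, hbd⟩ :=
    NegImag.exists_le_norm_det_boundary hGbar hG hGinf hGbarinf hprod hDC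
  exact NegImag.internallyStable_of_le_norm_det hGbar.1 hG.1 hc
    fun s hs => NegImag.le_norm_det_of_boundary hGbar.1 hG.1 hc hbd hτ hs
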